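/- Let $E$ be an elliptic curve over $\mathbf{Q}$ given by a Weierstrass equation $y^2+a_1xy+a_3y=x^3+a_2x^2+a_4x+a_6$ with $a_i\in\mathbf{Z}$ (not necessarily minimal) and discriminant $\Delta\neq 0$. For a nonzero point $P\in E(\mathbf{Q})$ let $\alpha(P),\beta(P),d(P)$ be the unique integers with $$P=\left(\frac{\alpha(P)}{d(P)^2},\frac{\beta(P)}{d(P)^3}\right),\qquad (\alpha(P),d(P))=(\beta(P),d(P))=1,\qquad d(P)\ge 1.$$ There is an algorithm with the following property. Let $Q\in E(\mathbf{Q})$ be such that, for every prime $\ell$ dividing $\Delta$, the reduction of $Q$ modulo $\ell$ is a nonsingular point of the given equation modulo $\ell$. Let $R\ge 1$ be odd, and let $m\ge 2$ be such that $mQ\neq 0$. Given the integers $a_1,a_2,a_3,a_4,a_6$, the modulus $R$, the values of $\alpha(Q)$, $\beta(Q)$, $d(Q)$ modulo $R$, and the binary digits of $m$, the algorithm computes $$\alpha(mQ),\qquad \varepsilon\,\beta(mQ),\qquad \varepsilon\,d(mQ)\pmod R$$ for some sign $\varepsilon\in\{1,-1\}$, the same in both places (it is not determined which). For fixed $E$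 its running time is $\widetilde O(\log R\,\log m)$. Precisely: let $X$ be the product of the numbers of binary digits of $R$ and of $m$. There are an integer $k\ge 0$ and, for each $E$, a constant $C$ such that the running time is at most $C\,X(\log X)^k$ for all $Q$, $R$, $m$ as above. Here an algorithm is a program with assignments, conditionals and while loops over finitely many integer variables and a sequential input tape, and its running time is its total bit cost. Let $b$ be the total binary length of the operands of an instruction. Assigning a constant, reading an input, testing a sign, adding and subtracting are charged $O(b)$. Multiplication and Euclidean division with remainder of integers are charged $b\,(\lfloor\log_2 b\rfloor+1)^2$. -/

import Mathlib

namespace DivPoly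

/-! ### Rational points in lowest terms -/

/-- The group `E(ℚ)` of the curve given by a Weierstrass equation with integer coefficients. -/
abbrev Point (W : WeierstrassCurve ℤ) : Type :=
  (W.map (Int.castRingHom ℚ)).toAffine.Point

/-- The integer `α(P)` in `x(P) = α(P) / d(P) ^ 2` (a placeholder `0` at the zero point, where
it is not defined). -/
def alpha {W : WeierstrassCurve ℤ} : Point W → ℤ
  | .zero => 0
  | .some x _ _ => x.num

/-- The integer `β(P)` in `y(P) = β(P) / d(P) ^ 3` (and `0` at the zero point). -/
def beta {W : WeierstrassCurve ℤ} : Point W → ℤ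
  | .zero => 0
  | .some _ y _ => y.num

/-- The positive integer `d(P)`: the square root of the denominator of `x(P)`
(and `0` at the zero point). -/
def denom {W : WeierstrassCurve ℤ} : Point W → ℤ
  | .zero => 0
  | .some x _ _ => (Nat.sqrt x.den : ℤ)

/-- The denominators of the coordinates of a point are a square and a cube of the same integer. -/
theorem exists_den {W : WeierstrassCurve ℤ} {x y : ℚ}
    (h : (W.map (Int.castRingHom ℚ)).toAffine.Nonsingular x y) :
    ∃ d : ℕ, 0 < d ∧ x.den = d ^ 2 ∧ y.den = d ^ 3 := by
  have heq := (WeierstrassCurve.Affine.equation_iff ..).mp h.1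
  simp only [WeierstrassCurve.map, eq_intCast] at heq
  obtain ⟨A, hA⟩ : ∃ A : ℤ, A = x.num := ⟨_, rfl⟩
  obtain ⟨B, hB⟩ : ∃ B : ℤ, B = (x.den : ℤ) := ⟨_, rfl⟩
  obtain ⟨C, hC⟩ : ∃ C : ℤ, C = y.num := ⟨_, rfl⟩
  obtain ⟨D, hD⟩ : ∃ D : ℤ, D = (y.den : ℤ) := ⟨_, rfl⟩
  have hBpos : 0 < B := by rw [hB]; exact_mod_cast x.pos
  have hDpos : 0 < D := by rw [hD]; exact_mod_cast y.pos
  have hAB : IsCoprime A B := by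
    rw [hA, hB, Int.isCoprime_iff_gcd_eq_one]; exact x.reduced
  have hCD : IsCoprime C D := by
    rw [hC, hD, Int.isCoprime_iff_gcd_eq_one]; exact y.reduced
  have hx : x = A / B := by rw [hA, hB]; exact_mod_cast (Rat.num_div_den x).symm
  have hy : y = C / D := by rw [hC, hD]; exact_mod_cast (Rat.num_div_den y).symm
  have hBq : (B : ℚ) ≠ 0 := by exact_mod_cast hBpos.ne'
  have hDq : (D : ℚ) ≠ 0 := by exact_mod_cast hDpos.ne'
  obtain ⟨N, hN⟩ : ∃ N : ℤ,
      N = A ^ 3 + W.a₂ * A ^ 2 * B + W.a₄ * A * B ^ 2 + W.a₆ * B ^ 3 := ⟨_, rfl⟩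
  have hNB : IsCoprime N B := by
    have h1 : IsCoprime (A ^ 3) B := hAB.pow_left
    have h2 : N = A ^ 3 + B * (W.a₂ * A ^ 2 + W.a₄ * A * B + W.a₆ * B ^ 2) := by rw [hN]; ring
    rw [h2]
    exact h1.add_mul_left_left _
  have key : B ^ 2 * (C ^ 2 * B + W.a₁ * A * C * D + W.a₃ * C * B * D) = D ^ 2 * N := by
    rw [hx, hy] at heq
    field_simp at heq
    rw [hN]
    have : (B : ℚ) ^ 2 * (C ^ 2 * B + W.a₁ * A * C * D + W.a₃ * C * B * D)
        = D ^ 2 * (A ^ 3 + W.a₂ * A ^ 2 * B + W.a₄ * A * B ^ 2 + W.a₆ * B ^ 3) := by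
      linear_combination heq
    exact_mod_cast this
  have hBD : B ∣ D := by
    have h1 : B ^ 2 ∣ D ^ 2 * N := ⟨_, key.symm⟩
    have h2 : IsCoprime (B ^ 2) N := hNB.symm.pow_left
    exact (Int.pow_dvd_pow_iff two_ne_zero).mp (h2.dvd_of_dvd_mul_right h1)
  obtain ⟨e, he⟩ := hBD
  have hepos : 0 < e := by
    rw [he] at hDpos
    exact pos_of_mul_pos_right hDpos hBpos.le
  have key2 : B * (C ^ 2 + e * (W.a₁ * A * C + W.a₃ * C * B)) = e ^ 2 * N := by
    have h3 : B ^ 2 ≠ 0 := pow_ne_zero 2 hBpos.ne'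
    apply mul_left_cancel₀ h3
    rw [he] at key
    linear_combination key
  have h1 : B ∣ e ^ 2 := hNB.symm.dvd_of_dvd_mul_right ⟨_, key2.symm⟩
  have h2 : e ^ 2 ∣ B := by
    have hCe : IsCoprime C e := hCD.of_isCoprime_of_dvd_right ⟨B, by rw [he]; ring⟩
    have h3 : IsCoprime (C ^ 2 + e * (W.a₁ * A * C + W.a₃ * C * B)) e :=
      (hCe.pow_left).add_mul_left_left _
    exact (h3.symm.pow_left).dvd_of_dvd_mul_right ⟨_, key2⟩
  have h3 : B = e ^ 2 := Int.dvd_antisymm hBpos.le (by positivity) h1 h2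
  refine ⟨e.toNat, by omega, ?_, ?_⟩
  · zify
    rw [Int.toNat_of_nonneg hepos.le, ← hB, h3]
  · zify
    rw [Int.toNat_of_nonneg hepos.le, ← hD, he, h3]
    ring

/-- `α`, `β`, `d` are the numbers of the unique representation
`(x, y) = (α / d ^ 2, β / d ^ 3)` with `d ≥ 1`, `(α, d) = (β, d) = 1`. -/
theorem coords_unique {W : WeierstrassCurve ℤ} {x y : ℚ}
    (h : (W.map (Int.castRingHom ℚ)).toAffine.Nonsingular x y) (a b d : ℤ) :
    (1 ≤ d ∧ IsCoprime a d ∧ IsCoprime b d ∧ x = a / d ^ 2 ∧ y = b / d ^ 3) ↔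
      (a = alpha (.some x y h : Point W) ∧ b = beta (.some x y h : Point W) ∧
        d = denom (.some x y h : Point W)) := by
  obtain ⟨e, he0, hex, hey⟩ := exists_den h
  simp only [alpha, beta, denom, hex, Nat.sqrt_eq']
  constructor
  · rintro ⟨hd, ha, hb, hx, hy⟩
    have hd2 : (0 : ℤ) < d ^ 2 := by positivity
    have hd3 : (0 : ℤ) < d ^ 3 := by positivity
    have ha2 : Nat.Coprime a.natAbs (d ^ 2).natAbs :=
      Int.isCoprime_iff_gcd_eq_one.mp ha.pow_right
    have hb3 : Nat.Coprime b.natAbs (d ^ 3).natAbs :=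
      Int.isCoprime_iff_gcd_eq_one.mp hb.pow_right
    have h1 := Rat.num_div_eq_of_coprime hd2 ha2
    have h2 := Rat.den_div_eq_of_coprime hd2 ha2
    have h3 := Rat.num_div_eq_of_coprime hd3 hb3
    push_cast at h1 h2 h3
    rw [← hx] at h1 h2
    rw [← hy] at h3
    refine ⟨h1.symm, h3.symm, ?_⟩
    rw [hex] at h2
    push_cast at h2
    have : (e : ℤ) ^ 2 = d ^ 2 := h2
    exact ((pow_left_inj₀ (by positivity) (by omega) two_ne_zero).mp this).symm
  · rintro ⟨rfl, rfl, rfl⟩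
    refine ⟨by exact_mod_cast he0, ?_, ?_, ?_, ?_⟩
    · have := x.reduced
      rw [hex] at this
      rw [Int.isCoprime_iff_gcd_eq_one]
      exact Nat.Coprime.coprime_dvd_right (dvd_pow_self e two_ne_zero) this
    · have := y.reduced
      rw [hey] at this
      rw [Int.isCoprime_iff_gcd_eq_one]
      exact Nat.Coprime.coprime_dvd_right (dvd_pow_self e three_ne_zero) this
    · have := (Rat.num_div_den x).symm
      rw [hex] at this
      exact_mod_cast this
    · have := (Rat.num_div_den y).symm
      rw [hey] at this
      exact_mod_cast this

/-- The nonzero point `Q` reduces to a nonsingular point of the Weierstrass equation modulo `ℓ`.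
In Jacobian (weighted projective) coordinates `[X : Y : Z]`, with `x = X / Z ^ 2` and
`y = Y / Z ^ 3`, the point `Q` is `[α(Q) : β(Q) : d(Q)]`, and its reduction is the class of this
triple modulo `ℓ`; it is the point at infinity, which is nonsingular, exactly when `ℓ ∣ d(Q)`. -/
def ReducesToNonsingular {W : WeierstrassCurve ℤ} (Q : Point W) (ℓ : ℕ) : Prop :=
  (W.map (Int.castRingHom (ZMod ℓ))).toJacobian.Nonsingular
    ![(alpha Q : ZMod ℓ), (beta Q : ZMod ℓ), (denom Q : ZMod ℓ)]

/-! ### Programs and their bit cost -/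

/-- The binary length of an integer, with one bit for the sign. -/
def len (x : ℤ) : ℕ := x.natAbs.size + 1

/-- Arithmetic operations; `div` and `mod` are Euclidean quotient and remainder. -/
inductive Op
  | add
  | sub
  | mul
  | div
  | mod

/-- The value of an operation. -/
def Op.eval : Op → ℤ → ℤ → ℤ
  | .add, x, y => x + y
  | .sub, x, y => x - y
  | .mul, x, y => x * y
  | .div, x, y => x / y
  | .mod, x, y => x % y

/-- The bit cost of an operation on operands of total length `b`: linear for addition and
subtraction, and `b * (size b) ^ 2`, where `size b` is about `log b`, for multiplication and
division with remainder. The latter is above the Schönhage–Strassen bound `O(b log b log log b)`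
for the number of bit operations, so that nothing is charged below its cost in bit operations. -/
def Op.cost : Op → ℤ → ℤ → ℕ
  | .add, x, y => len x + len y
  | .sub, x, y => len x + len y
  | .mul, x, y => (len x + len y) * (Nat.size (len x + len y)) ^ 2
  | .div, x, y => (len x + len y) * (Nat.size (len x + len y)) ^ 2
  | .mod, x, y => (len x + len y) * (Nat.size (len x + len y)) ^ 2

/-- Programs over integer registers `r₀, r₁, …` (each program mentions finitely many) and a
one-way read-only input tape that holds a list of integers. -/
inductive Prog
  /-- `rᵢ := c`. -/
  | const (i : ℕ) (c : ℤ)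
  /-- `rᵢ := rⱼ o rₖ`. -/
  | arith (o : Op) (i j k : ℕ)
  /-- `rᵢ :=` the next entry of the input, or `-1` when the input is used up. -/
  | read (i : ℕ)
  /-- `p` followed by `q`. -/
  | seq (p q : Prog)
  /-- `if 0 < rᵢ then p else q`. -/
  | ifPos (i : ℕ) (p q : Prog)
  /-- `while 0 < rᵢ do p`. -/
  | whilePos (i : ℕ) (p : Prog)

/-- Contents of the registers and the unread part of the input. -/
structure State where
  /-- The registers. -/
  reg : ℕ → ℤ
  /-- The unread part of the input. -/
  input : List ℤ

/-- The state with register `i` overwritten by `v`. -/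
def State.set (s : State) (i : ℕ) (v : ℤ) : State :=
  ⟨Function.update s.reg i v, s.input⟩

/-- The initial state: all registers are zero. -/
def State.init (input : List ℤ) : State := ⟨fun _ => 0, input⟩

/-- `Exec p s s' t`: started in state `s`, the program `p` halts in state `s'` after time `t`
(the total bit cost of the executed instructions and tests). -/
inductive Exec : Prog → State → State → ℕ → Prop
  | const (i : ℕ) (c : ℤ) (s : State) :
      Exec (.const i c) s (s.set i c) (len c)
  | arith (o : Op) (i j k : ℕ) (s : State) :
      Exec (.arith o i j k) s (s.set i (o.eval (s.reg j) (s.reg k)))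
        (o.cost (s.reg j) (s.reg k))
  | read_cons (i : ℕ) (r : ℕ → ℤ) (a : ℤ) (l : List ℤ) :
      Exec (.read i) ⟨r, a :: l⟩ ⟨Function.update r i a, l⟩ (len a)
  | read_nil (i : ℕ) (r : ℕ → ℤ) :
      Exec (.read i) ⟨r, []⟩ ⟨Function.update r i (-1), []⟩ (len (-1))
  | seq {p q : Prog} {s s' s'' : State} {t t' : ℕ} :
      Exec p s s' t → Exec q s' s'' t' → Exec (.seq p q) s s'' (t + t')
  | if_pos {i : ℕ} {p q : Prog} {s s' : State} {t : ℕ} :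
      0 < s.reg i → Exec p s s' t → Exec (.ifPos i p q) s s' (len (s.reg i) + t)
  | if_neg {i : ℕ} {p q : Prog} {s s' : State} {t : ℕ} :
      s.reg i ≤ 0 → Exec q s s' t → Exec (.ifPos i p q) s s' (len (s.reg i) + t)
  | while_pos {i : ℕ} {p : Prog} {s s' s'' : State} {t t' : ℕ} :
      0 < s.reg i → Exec p s s' t → Exec (.whilePos i p) s' s'' t' →
      Exec (.whilePos i p) s s'' (len (s.reg i) + t + t')
  | while_neg {i : ℕ} {p : Prog} {s : State} :
      s.reg i ≤ 0 → Exec (.whilePos i p) s s (len (s.reg i))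

/-- The binary digits of `m`, most significant digit first. -/
def bits (m : ℕ) : List ℤ := (Nat.digits 2 m).reverse.map (fun b => (b : ℤ))

/-- The input of the algorithm: the coefficients of the curve, the modulus `R`, the residues of
`α(Q)`, `β(Q)`, `d(Q)` in `{0, …, R - 1}`, and the binary digits of `m`. -/
def inputOf (W : WeierstrassCurve ℤ) (Q : Point W) (R m : ℕ) : List ℤ :=
  [W.a₁, W.a₂, W.a₃, W.a₄, W.a₆, (R : ℤ), alpha Q % R, beta Q % R, denom Q % R] ++ bits m

end DivPoly

/-! Put `d = d(Q)`. The pair `(α(Q), β(Q))` is an integral point of the curve `U` with coefficients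
`dⁱ aᵢ`, and multiplying the third Jacobian coordinate by `d` leads from `U` back to `W`. A binary
ladder on `U`, started at `[1 : 1 : 0]` and `[α(Q) : β(Q) : 1]`, carries representatives of `nQ` and
`(n + 1)Q`. It uses only integral polynomials, so it can be run modulo `R`. These two points always
differ by the starting point, so the addition formula never meets two equal points, and doubling has
no exceptions. Hence the ladder is correct over every field in which the start is a nonsingular
point other than zero (`represents_ladder`).

Over `ℚ` this shows that the output `(X, Y, Z)`, with `Z` replaced by `dZ`, represents `mQ`. Over
`ZMod ℓ` it shows that nothing cancels. If `ℓ ∤ d`, the output is a nonsingular point of `W` modulo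
`ℓ`, so `X` and `Y` are nonzero where `dZ` vanishes. If `ℓ ∣ d`, then `U` reduces to the cusp `y² =
x³`, the start is a nonsingular point of it, and so is every multiple (`ladderCoords_zmod_ne_zero`).
Therefore `X` and `Y` are coprime to `dZ`, and uniqueness of lowest terms gives exact integer
equalities up to the sign of `dZ` (`ladderCoords_spec`).

Each ladder step costs boundedly many multiplications modulo `R` (`modTransform_stepVec`), and there
is one step per digit of `m` (`exists_prog_fold`). This gives the bound with `k = 2`. -/

namespace DivPoly

/-! ### Bit costs modulo `R` -/

/-- The bound for the bit cost of a multiplication modulo `R`. -/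
def mulCost (R : ℕ) : ℕ := R.size * (R.size.size) ^ 2

theorem one_le_size {n : ℕ} (h : 1 ≤ n) : 1 ≤ n.size := Nat.size_pos.mpr h

theorem one_le_mulCost {R : ℕ} (h : 1 ≤ R) : 1 ≤ mulCost R :=
  Nat.mul_pos (one_le_size h) (pow_pos (one_le_size (one_le_size h)) 2)

theorem size_le_mulCost {R : ℕ} (h : 1 ≤ R) : R.size ≤ mulCost R :=
  Nat.le_mul_of_pos_right _ (pow_pos (one_le_size (one_le_size h)) 2)

theorem size_mul_le (a b : ℕ) : (a * b).size ≤ a.size + b.size := by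
  rcases Nat.eq_zero_or_pos b with rfl | hb
  · simp
  rw [Nat.size_le, pow_add]
  exact Nat.mul_lt_mul_of_lt_of_le (Nat.lt_size_self a) (Nat.lt_size_self b).le (by positivity)

theorem size_add_le (a b : ℕ) : (a + b).size ≤ a.size + b.size + 1 := by
  rw [Nat.size_le]
  have ha := Nat.lt_size_self a
  have hb := Nat.lt_size_self b
  have h1 : 2 ^ a.size ≤ 2 ^ (a.size + b.size) := Nat.pow_le_pow_right two_pos (by omega)
  have h2 : 2 ^ b.size ≤ 2 ^ (a.size + b.size) := Nat.pow_le_pow_right two_pos (by omega)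
  rw [pow_succ]
  omega

theorem one_le_len (x : ℤ) : 1 ≤ len x := Nat.le_add_left _ _

/-- Every cost estimate passes through this bound. A factor `K` in the length adds only `K.size` to
its own binary length, and `a + b ≤ (a + 1) * b` for `b ≥ 1` turns this into a constant factor. -/
theorem Op.cost_le_of_len_le (o : Op) {x y : ℤ} {K R : ℕ} (hR : 1 ≤ R)
    (h : len x + len y ≤ K * R.size) : o.cost x y ≤ K * (K.size + 1) ^ 2 * mulCost R := by
  have h1 : o.cost x y ≤ (len x + len y) * (len x + len y).size ^ 2 := by
    cases o <;> simp only [Op.cost, le_refl]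
    all_goals
      exact Nat.le_mul_of_pos_right _ (pow_pos (one_le_size (by linarith [one_le_len x])) 2)
  have h2 : (len x + len y).size ≤ (K.size + 1) * R.size.size := by
    have h3 := (Nat.size_le_size h).trans (size_mul_le K R.size)
    have h4 := one_le_size (one_le_size hR)
    nlinarith
  calc o.cost x y ≤ (K * R.size) * ((K.size + 1) * R.size.size) ^ 2 :=
        h1.trans (Nat.mul_le_mul h (Nat.pow_le_pow_left h2 2))
    _ = _ := by rw [mulCost]; ring

theorem len_le_of_natAbs_le {x : ℤ} {n : ℕ} (h : x.natAbs ≤ n) : len x ≤ n.size + 1 :=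
  Nat.add_le_add_right (Nat.size_le_size h) 1

theorem len_emod_le (x : ℤ) {R : ℕ} (hR : 1 ≤ R) : len (x % R) ≤ 2 * R.size := by
  have h1 := Int.emod_nonneg x (b := R) (by omega)
  have h2 := Int.emod_lt_of_pos x (b := R) (by omega)
  have := len_le_of_natAbs_le (x := x % R) (n := R) (by omega)
  have := one_le_size hR
  omega

theorem len_natCast_le {R : ℕ} (hR : 1 ≤ R) : len R ≤ 2 * R.size := by
  have := len_le_of_natAbs_le (x := R) (n := R) (by simp)
  have := one_le_size hR
  omega

/-- The operations that are compatible with congruences. -/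
def Op.IsRingOp (o : Op) : Prop := o = .add ∨ o = .sub ∨ o = .mul

theorem Op.len_eval_le {o : Op} (ho : o.IsRingOp) (x y : ℤ) :
    len (o.eval x y) ≤ len x + len y := by
  simp only [len]
  rcases ho with rfl | rfl | rfl
  · have := Nat.size_le_size (Int.natAbs_add_le x y)
    have := size_add_le x.natAbs y.natAbs
    simp only [Op.eval]
    omega
  · have := Nat.size_le_size (Int.natAbs_sub_le x y)
    have := size_add_le x.natAbs y.natAbs
    simp only [Op.eval]
    omega
  · have := size_mul_le x.natAbs y.natAbs
    simp only [Op.eval, Int.natAbs_mul]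
    omega

theorem Op.eval_emod {o : Op} (ho : o.IsRingOp) (x y R : ℤ) :
    o.eval (x % R) (y % R) % R = o.eval x y % R := by
  rcases ho with rfl | rfl | rfl <;> simp [Op.eval, Int.add_emod, Int.sub_emod, Int.mul_emod]

/-! ### Programs that compute modulo `R` -/

theorem State.set_reg (s : State) (i : ℕ) (v : ℤ) (j : ℕ) :
    (s.set i v).reg j = if j = i then v else s.reg j := by
  simp [State.set, Function.update_apply]

theorem State.set_input (s : State) (i : ℕ) (v : ℤ) : (s.set i v).input = s.input := rfl

variable {N : ℕ}

/-- The registers `0, …, N - 1` hold the residues of `v` modulo `R`, register `N` holds `R`. -/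
structure State.Holds (s : State) (R : ℕ) (v : Fin N → ℤ) : Prop where
  modulus : s.reg N = R
  data : ∀ i : Fin N, s.reg i = v i % R

theorem State.Holds.of_eq {s s' : State} {R : ℕ} {v : Fin N → ℤ} (h : s.Holds R v)
    (he : ∀ i ≤ N, s'.reg i = s.reg i) : s'.Holds R v :=
  ⟨(he N le_rfl).trans h.modulus, fun i => (he i i.2.le).trans (h.data i)⟩

/-- For every target register `t > N` there is a program that puts the residue of `f v` into
register `t`, where `v` is held by the registers below `N`, leaves the registers below `t` alone
and has the bit cost of a bounded number of multiplications modulo `R`. -/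
def ModComputable (f : (Fin N → ℤ) → ℤ) : Prop :=
  ∀ t, N < t → ∃ (P : Prog) (C : ℕ), ∀ (R : ℕ) (v : Fin N → ℤ) (s : State), 1 ≤ R →
    s.Holds R v → ∃ s' τ, Exec P s s' τ ∧ s'.reg t = f v % R ∧
      (∀ i < t, s'.reg i = s.reg i) ∧ s'.input = s.input ∧ τ ≤ C * mulCost R

/-! ### Closure of residue computations under the ring operations. -/

namespace ModComputable

theorem const (c : ℤ) : ModComputable (fun _ : Fin N → ℤ => c) := by
  intro t ht
  refine ⟨.seq (.const t c) (.arith .mod t t N),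
    len c + (len c + 2) * ((len c + 2).size + 1) ^ 2, fun R v s hR hs => ?_⟩
  refine ⟨_, _, .seq (.const _ _ _) (.arith _ _ _ _ _), ?_, ?_, rfl, ?_⟩
  · simp [State.set_reg, Op.eval, ht.ne, hs.modulus]
  · intro i hi
    simp [State.set_reg, hi.ne]
  · simp only [State.set_reg, if_pos, ht.ne, if_false, hs.modulus]
    rw [add_mul]
    refine add_le_add (Nat.le_mul_of_pos_right _ (one_le_mulCost hR))
      (Op.cost_le_of_len_le _ hR ?_)
    have := len_natCast_le hR
    have := one_le_size hR
    nlinarith [one_le_len c]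

theorem coord (j : Fin N) : ModComputable (fun v : Fin N → ℤ => v j) := by
  intro t ht
  -- Reducing a residue once more serves as a copy instruction. Residue and modulus have length at
  -- most `2 * R.size` each, hence the 4.
  refine ⟨.arith .mod t j N, 4 * (Nat.size 4 + 1) ^ 2, fun R v s hR hs => ?_⟩
  refine ⟨_, _, .arith _ _ _ _ _, ?_, ?_, rfl, ?_⟩
  · simp [State.set_reg, Op.eval, hs.modulus, hs.data]
  · intro i hi
    simp [State.set_reg, hi.ne]
  · refine Op.cost_le_of_len_le _ hR ?_
    rw [hs.modulus, hs.data]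
    have := len_natCast_le hR
    have := len_emod_le (v j) hR
    omega

/-- The registers from `t` upwards act as an evaluation stack: `g` is evaluated at `t + 1`, which
preserves both the data and the value of `f` in register `t`. -/
theorem op {o : Op} (ho : o.IsRingOp) {f g : (Fin N → ℤ) → ℤ} (hf : ModComputable f)
    (hg : ModComputable g) : ModComputable (fun v => o.eval (f v) (g v)) := by
  intro t ht
  obtain ⟨P, C, hP⟩ := hf t ht
  obtain ⟨Q, D, hQ⟩ := hg (t + 1) (by omega)
  refine ⟨.seq P (.seq Q (.seq (.arith o t t (t + 1)) (.arith .mod t t N))),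
    -- The 4 is for the operation on two residues; the 6 is for reducing its result, of length at
    -- most `4 * R.size`, by the modulus.
    C + (D + (4 * (Nat.size 4 + 1) ^ 2 + 6 * (Nat.size 6 + 1) ^ 2)), fun R v s hR hs => ?_⟩
  obtain ⟨s₁, τ₁, e₁, r₁, u₁, i₁, c₁⟩ := hP R v s hR hs
  have hs₁ : s₁.Holds R v := hs.of_eq fun i hi => u₁ i (by omega)
  obtain ⟨s₂, τ₂, e₂, r₂, u₂, i₂, c₂⟩ := hQ R v s₁ hR hs₁
  have hs₂ : s₂.Holds R v := hs₁.of_eq fun i hi => u₂ i (by omega)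
  have r₃ : s₂.reg t = f v % R := (u₂ t (by omega)).trans r₁
  refine ⟨_, _, .seq e₁ (.seq e₂ (.seq (.arith _ _ _ _ _) (.arith _ _ _ _ _))), ?_, ?_, ?_, ?_⟩
  · simp [State.set_reg, ht.ne, hs₂.modulus, r₂, r₃]
    exact Op.eval_emod ho _ _ _
  · intro i hi
    simp [State.set_reg, hi.ne, u₂ i (by omega), u₁ i hi]
  · simp [State.set_input, i₂, i₁]
  · simp only [State.set_reg, if_pos, ht.ne, if_false, hs₂.modulus, r₂, r₃]
    have h1 := len_emod_le (f v) hR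
    have h2 := len_emod_le (g v) hR
    have h3 := len_natCast_le hR
    have h4 := Op.len_eval_le ho (f v % R) (g v % R)
    simp only [add_mul]
    exact add_le_add c₁ (add_le_add c₂ (add_le_add (Op.cost_le_of_len_le _ hR (by omega))
      (Op.cost_le_of_len_le _ hR (by omega))))

theorem add {f g : (Fin N → ℤ) → ℤ} (hf : ModComputable f) (hg : ModComputable g) :
    ModComputable (fun v => f v + g v) :=
  op (o := .add) (.inl rfl) hf hg

theorem sub {f g : (Fin N → ℤ) → ℤ} (hf : ModComputable f) (hg : ModComputable g) :
    ModComputable (fun v => f v - g v) :=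
  op (o := .sub) (.inr (.inl rfl)) hf hg

theorem mul {f g : (Fin N → ℤ) → ℤ} (hf : ModComputable f) (hg : ModComputable g) :
    ModComputable (fun v => f v * g v) :=
  op (o := .mul) (.inr (.inr rfl)) hf hg

theorem neg {f : (Fin N → ℤ) → ℤ} (hf : ModComputable f) : ModComputable (fun v => -f v) := by
  simpa using sub (const 0) hf

theorem pow {f : (Fin N → ℤ) → ℤ} (hf : ModComputable f) (n : ℕ) :
    ModComputable (fun v => f v ^ n) := by
  induction n with
  | zero => simpa using const 1
  | succ n ih => simpa only [pow_succ] using mul ih hf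

end ModComputable

/-- There is a program that replaces the vector `v` of residues held by the registers below `N` by
the vector of residues of `F v`, leaves the registers `N, …, N + 3` alone and has the bit cost of a
bounded number of multiplications modulo `R`. -/
def ModTransform (F : (Fin N → ℤ) → (Fin N → ℤ)) : Prop :=
  ∃ (P : Prog) (C : ℕ), ∀ (R : ℕ) (v : Fin N → ℤ) (s : State), 1 ≤ R →
    s.Holds R v → ∃ s' τ, Exec P s s' τ ∧ s'.Holds R (F v) ∧
      (∀ i, N ≤ i → i < N + 4 → s'.reg i = s.reg i) ∧ s'.input = s.input ∧ τ ≤ C * mulCost R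

/-- Each coordinate of `F v` may depend on all of `v`, so the new values are collected above
register `N + 3` before any old value is overwritten. -/
theorem exists_prog_temporaries {F : (Fin N → ℤ) → (Fin N → ℤ)}
    (hF : ∀ i, ModComputable (fun v => F v i)) (k : ℕ) (hk : k ≤ N) :
    ∃ (P : Prog) (C : ℕ), ∀ (R : ℕ) (v : Fin N → ℤ) (s : State), 1 ≤ R →
      s.Holds R v → ∃ s' τ, Exec P s s' τ ∧
        (∀ i : Fin N, i < k → s'.reg (N + 4 + i) = F v i % R) ∧
        (∀ i < N + 4, s'.reg i = s.reg i) ∧ s'.input = s.input ∧ τ ≤ C * mulCost R := by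
  induction k with
  | zero =>
    -- A harmless write stands for the empty program.
    refine ⟨.const (N + 4) 0, 1, fun R v s hR hs => ⟨_, _, .const _ _ _, ?_, ?_, rfl, ?_⟩⟩
    · simp
    · intro i hi
      simp [State.set_reg, hi.ne]
    · simpa [len] using one_le_mulCost hR
  | succ k ih =>
    obtain ⟨P, C, hP⟩ := ih (by omega)
    obtain ⟨Q, D, hQ⟩ := hF ⟨k, by omega⟩ (N + 4 + k) (by omega)
    refine ⟨.seq P Q, C + D, fun R v s hR hs => ?_⟩
    obtain ⟨s₁, τ₁, e₁, r₁, u₁, i₁, c₁⟩ := hP R v s hR hs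
    obtain ⟨s₂, τ₂, e₂, r₂, u₂, i₂, c₂⟩ :=
      hQ R v s₁ hR (hs.of_eq fun i hi => u₁ i (by omega))
    refine ⟨s₂, _, .seq e₁ e₂, ?_, ?_, i₂.trans i₁, ?_⟩
    · intro i hi
      rcases Nat.lt_succ_iff_lt_or_eq.mp hi with hi | hi
      · rw [u₂ _ (by omega), r₁ i hi]
      · have hi' : i = ⟨k, by omega⟩ := Fin.ext hi
        rw [hi']
        exact r₂
    · intro i hi
      rw [u₂ i (by omega), u₁ i hi]
    · rw [add_mul]
      exact add_le_add c₁ c₂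

theorem exists_prog_copy (k : ℕ) (hk : k ≤ N) :
    ∃ (P : Prog) (C : ℕ), ∀ (R : ℕ) (w : Fin N → ℤ) (s : State), 1 ≤ R → s.reg N = R →
      (∀ i : Fin N, s.reg (N + 4 + i) = w i % R) → ∃ s' τ, Exec P s s' τ ∧
        (∀ i : Fin N, i < k → s'.reg i = w i % R) ∧
        (∀ i, N ≤ i → i < N + 4 + N → s'.reg i = s.reg i) ∧ s'.input = s.input ∧
        τ ≤ C * mulCost R := by
  induction k with
  | zero =>
    refine ⟨.const (N + 4 + N) 0, 1,
      fun R v s hR _ _ => ⟨_, _, .const _ _ _, ?_, ?_, rfl, ?_⟩⟩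
    · simp
    · intro i _ hi
      simp [State.set_reg, hi.ne]
    · simpa [len] using one_le_mulCost hR
  | succ k ih =>
    obtain ⟨P, C, hP⟩ := ih (by omega)
    refine ⟨.seq P (.arith .mod k (N + 4 + k) N), C + 4 * (Nat.size 4 + 1) ^ 2,
      fun R w s hR hN hs => ?_⟩
    obtain ⟨s₁, τ₁, e₁, r₁, u₁, i₁, c₁⟩ := hP R w s hR hN hs
    have h1 : s₁.reg (N + 4 + k) = w ⟨k, by omega⟩ % R := by
      rw [u₁ _ (by omega) (by omega), ← hs ⟨k, by omega⟩]
    have h2 : s₁.reg N = R := by rw [u₁ _ (by omega) (by omega), hN]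
    refine ⟨_, _, .seq e₁ (.arith _ _ _ _ _), ?_, ?_, i₁, ?_⟩
    · intro i hi
      rcases Nat.lt_succ_iff_lt_or_eq.mp hi with hi | hi
      · simp [State.set_reg, hi.ne, r₁ i hi]
      · have hi' : i = ⟨k, by omega⟩ := Fin.ext hi
        simp [hi', State.set_reg, Op.eval, h1, h2]
    · intro i hi hi'
      simp [State.set_reg, (show i ≠ k by omega), u₁ i hi hi']
    · rw [add_mul]
      refine add_le_add c₁ (Op.cost_le_of_len_le _ hR ?_)
      rw [h1, h2]
      have := len_natCast_le hR
      have := len_emod_le (w ⟨k, by omega⟩) hR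
      omega

theorem modTransform_of_modComputable {F : (Fin N → ℤ) → (Fin N → ℤ)}
    (hF : ∀ i, ModComputable (fun v => F v i)) : ModTransform F := by
  obtain ⟨P, C, hP⟩ := exists_prog_temporaries hF N le_rfl
  obtain ⟨Q, D, hQ⟩ := exists_prog_copy (N := N) N le_rfl
  refine ⟨.seq P Q, C + D, fun R v s hR hs => ?_⟩
  obtain ⟨s₁, τ₁, e₁, r₁, u₁, i₁, c₁⟩ := hP R v s hR hs
  have hN : s₁.reg N = R := by rw [u₁ _ (by omega), hs.modulus]
  obtain ⟨s₂, τ₂, e₂, r₂, u₂, i₂, c₂⟩ := hQ R (F v) s₁ hR hN fun i => r₁ i i.2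
  refine ⟨s₂, _, .seq e₁ e₂, ⟨?_, fun i => r₂ i i.2⟩, ?_, i₂.trans i₁, ?_⟩
  · rw [u₂ _ (by omega) (by omega), hN]
  · intro i hi hi'
    rw [u₂ i hi (by omega), u₁ i hi']
  · rw [add_mul]
    exact add_le_add c₁ c₂

/-! ### Reading a string of bits -/

theorem Exec.read_of_input {s : State} {a : ℤ} {l : List ℤ} (i : ℕ) (h : s.input = a :: l) :
    Exec (.read i) s ⟨Function.update s.reg i a, l⟩ (len a) := by
  obtain ⟨r, _⟩ := s
  subst h
  exact .read_cons i r a l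

theorem Exec.read_of_input_nil {s : State} (i : ℕ) (h : s.input = []) :
    Exec (.read i) s ⟨Function.update s.reg i (-1), []⟩ (len (-1)) := by
  obtain ⟨r, _⟩ := s
  subst h
  exact .read_nil i r

/-- Read the next bit into register `N + 1` and put its successor into register `N + 2`; at the
end of the input the latter becomes `0`. Register `N + 3` has to hold `1`. -/
def readBit (N : ℕ) : Prog := .seq (.read (N + 1)) (.arith .add (N + 2) (N + 1) (N + 3))

theorem exec_readBit {s : State} {a : ℤ} {l : List ℤ} (h1 : s.reg (N + 3) = 1)
    (h : s.input = a :: l) : ∃ s', Exec (readBit N) s s' (len a + (len a + len 1)) ∧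
      s'.input = l ∧ s'.reg (N + 1) = a ∧ s'.reg (N + 2) = a + 1 ∧ s'.reg (N + 3) = 1 ∧
      ∀ i ≤ N, s'.reg i = s.reg i := by
  have e := Exec.seq (Exec.read_of_input (N + 1) h) (.arith .add (N + 2) (N + 1) (N + 3) _)
  simp only [Function.update_self, Op.cost, Op.eval, h1, ne_eq, Nat.add_left_cancel_iff,
    OfNat.ofNat_ne_one, not_false_eq_true, Function.update_of_ne] at e
  refine ⟨_, e, rfl, ?_, ?_, ?_, ?_⟩
  · simp [State.set_reg]
  · simp [State.set_reg]
  · simp [State.set_reg, h1]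
  · intro i hi
    simp [State.set_reg, (show i ≠ N + 2 by omega), (show i ≠ N + 1 by omega)]

theorem exec_readBit_nil {s : State} (h1 : s.reg (N + 3) = 1)
    (h : s.input = []) : ∃ s', Exec (readBit N) s s' (len (-1) + (len (-1) + len 1)) ∧
      s'.reg (N + 2) = 0 ∧ ∀ i ≤ N, s'.reg i = s.reg i := by
  have e := Exec.seq (Exec.read_of_input_nil (N + 1) h) (.arith .add (N + 2) (N + 1) (N + 3) _)
  simp only [Function.update_self, Op.cost, Op.eval, h1, ne_eq, Nat.add_left_cancel_iff,
    OfNat.ofNat_ne_one, not_false_eq_true, Function.update_of_ne] at e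
  refine ⟨_, e, ?_, ?_⟩
  · simp [State.set_reg]
  · intro i hi
    simp [State.set_reg, (show i ≠ N + 2 by omega), (show i ≠ N + 1 by omega)]

/-- Two transformations, applied according to the bits of a string that is read from the input. -/
theorem exists_prog_fold {F₀ F₁ : (Fin N → ℤ) → (Fin N → ℤ)} (h₀ : ModTransform F₀)
    (h₁ : ModTransform F₁) : ∃ (P : Prog) (C : ℕ), ∀ (R : ℕ), 1 ≤ R → ∀ (l : List ℕ),
      (∀ b ∈ l, b < 2) → ∀ (v : Fin N → ℤ) (s : State), s.Holds R v → s.reg (N + 3) = 1 →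
      s.input = l.map (fun b : ℕ => (b : ℤ)) →
      ∃ s' τ, Exec P s s' τ ∧ s'.Holds R (l.foldl (fun w b => if b = 0 then F₀ w else F₁ w) v) ∧
        τ ≤ C * (mulCost R * (l.length + 1)) := by
  obtain ⟨P₀, C₀, hP₀⟩ := h₀
  obtain ⟨P₁, C₁, hP₁⟩ := h₁
  -- The loop tests the bit plus one, so both bits continue it and the end marker `-1` stops it. One
  -- read is done before the loop, and the body ends with the next one.
  obtain ⟨B, hB⟩ : ∃ B, B = Prog.seq (.ifPos (N + 1) P₁ P₀) (readBit N) := ⟨_, rfl⟩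
  -- In the 14, the branch test takes 2, and the remaining 12 cover a read with its increment and
  -- the loop test.
  refine ⟨.seq (readBit N) (.whilePos (N + 2) B), C₀ + C₁ + 14, fun R hR l => ?_⟩
  -- Separating the read from the loop makes the induction work: the read at the end of the body and
  -- the remaining loop are the two executions supplied for the tail.
  suffices H : (∀ b ∈ l, b < 2) → ∀ (v : Fin N → ℤ) (s : State), s.Holds R v →
      s.reg (N + 3) = 1 → s.input = l.map (fun b : ℕ => (b : ℤ)) →
      ∃ s₁ s' τ₁ τ₂, Exec (readBit N) s s₁ τ₁ ∧ Exec (.whilePos (N + 2) B) s₁ s' τ₂ ∧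
        s'.Holds R (l.foldl (fun w b => if b = 0 then F₀ w else F₁ w) v) ∧
        τ₁ + τ₂ ≤ (C₀ + C₁ + 14) * (mulCost R * (l.length + 1)) by
    intro hl v s hs h1 hi
    obtain ⟨s₁, s', τ₁, τ₂, e₁, e₂, h, hτ⟩ := H hl v s hs h1 hi
    exact ⟨s', _, .seq e₁ e₂, h, hτ⟩
  have hL := one_le_mulCost hR
  have len1 : len 1 = 2 := rfl
  have len0 : len 0 = 1 := rfl
  have lenm1 : len (-1) = 2 := rfl
  induction l with
  | nil =>
    intro _ v s hs h1 hi
    obtain ⟨s₁, e₁, hc, hu⟩ := exec_readBit_nil h1 hi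
    refine ⟨s₁, s₁, _, _, e₁, .while_neg hc.le, hs.of_eq hu, ?_⟩
    rw [hc, len1, len0, lenm1]
    simp only [List.length_nil]
    nlinarith
  | cons b l ih =>
    intro hl v s hs h1 hi
    obtain ⟨s₁, e₁, i₁, hb₁, hc₁, ho₁, hu₁⟩ := exec_readBit (a := (b : ℤ)) h1 hi
    have hs₁ : s₁.Holds R v := hs.of_eq hu₁
    obtain ⟨s₂, τ₂, e₂, hs₂, u₂, i₂, c₂⟩ : ∃ s₂ τ₂, Exec (.ifPos (N + 1) P₁ P₀) s₁ s₂ τ₂ ∧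
        s₂.Holds R (if b = 0 then F₀ v else F₁ v) ∧
        (∀ i, N ≤ i → i < N + 4 → s₂.reg i = s₁.reg i) ∧ s₂.input = s₁.input ∧
        τ₂ ≤ (C₀ + C₁ + 2) * mulCost R := by
      have hb2 := hl b (by simp)
      obtain rfl | rfl : b = 0 ∨ b = 1 := by omega
      · obtain ⟨s₂, τ₂, e₂, hs₂, u₂, i₂, c₂⟩ := hP₀ R v s₁ hR hs₁
        refine ⟨s₂, _, .if_neg hb₁.le e₂, by simpa using hs₂, u₂, i₂, ?_⟩
        rw [hb₁, Nat.cast_zero, len0]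
        nlinarith
      · obtain ⟨s₂, τ₂, e₂, hs₂, u₂, i₂, c₂⟩ := hP₁ R v s₁ hR hs₁
        refine ⟨s₂, _, .if_pos (by simp [hb₁]) e₂, by simpa using hs₂, u₂, i₂, ?_⟩
        rw [hb₁, Nat.cast_one, len1]
        nlinarith
    obtain ⟨s₃, s₄, τ₃, τ₄, e₃, e₄, hs₄, c₄⟩ := ih (fun c hc => hl c (by simp [hc])) _ s₂ hs₂
      (by rw [u₂ _ (by omega) (by omega), ho₁]) (by rw [i₂, i₁])
    refine ⟨s₁, s₄, _, _, e₁, .while_pos (by omega) (hB ▸ Exec.seq e₂ e₃) e₄, hs₄, ?_⟩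
    have hlen : len (b : ℤ) ≤ 2 ∧ len ((b : ℤ) + 1) ≤ 3 := by
      have hb2 := hl b (by simp)
      obtain rfl | rfl : b = 0 ∨ b = 1 := by omega
      · decide
      · decide
    rw [hc₁, len1]
    simp only [List.length_cons]
    have : (C₀ + C₁ + 14) * (mulCost R * (l.length + 1 + 1)) =
      (C₀ + C₁ + 14) * (mulCost R * (l.length + 1)) + (C₀ + C₁ + 2) * mulCost R
        + 12 * mulCost R := by ring
    omega

end DivPoly

namespace DivPoly

open WeierstrassCurve WeierstrassCurve.Jacobian

/-! ### The binary ladder in scaled Jacobian coordinates -/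

section Scaling

variable {A B : Type*} [CommRing A] [CommRing B]

/-- The curve with coefficients `aᵢ cⁱ`. -/
def scaleCurve (c : A) (V : WeierstrassCurve A) : WeierstrassCurve A :=
  ⟨c * V.a₁, c ^ 2 * V.a₂, c ^ 3 * V.a₃, c ^ 4 * V.a₄, c ^ 6 * V.a₆⟩

/-- If `P` represents a point of `scaleCurve c V`, then `scaleZ c P` represents a point of `V`. -/
def scaleZ (c : A) (P : Fin 3 → A) : Fin 3 → A := ![P 0, P 1, c * P 2]

theorem scaleCurve_map (f : A →+* B) (c : A) (V : WeierstrassCurve A) :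
    (scaleCurve c V).map f = scaleCurve (f c) (V.map f) := by
  simp [scaleCurve, WeierstrassCurve.map]

/-- Apart from the products `aᵢ Zⁱ`, doubling involves `Z` only as one factor of the third
coordinate. -/
theorem dblXYZ_scaleZ (c : A) (V : WeierstrassCurve A) (P : Fin 3 → A) :
    V.toJacobian.dblXYZ (scaleZ c P) = scaleZ c ((scaleCurve c V).toJacobian.dblXYZ P) := by
  ext i
  fin_cases i <;>
    simp [dblXYZ, dblX, dblY, dblZ, negDblY, negY, dblU_eq, scaleZ, scaleCurve] <;> ring

/-- The extra factor `c` acts with Jacobian weights `(2, 3, 1)`. It does not change the point when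
`c` is a unit, which is why `Represents.add` needs `c ≠ 0`. -/
theorem addXYZ_scaleZ (c : A) (V : WeierstrassCurve A) (P Q : Fin 3 → A) :
    V.toJacobian.addXYZ (scaleZ c P) (scaleZ c Q) =
      c • scaleZ c ((scaleCurve c V).toJacobian.addXYZ P Q) := by
  rw [smul_fin3]
  ext i
  fin_cases i <;>
    simp [addXYZ, addX, addY, addZ, negAddY, negY, scaleZ, scaleCurve] <;> ring

end Scaling

section Represents

variable {F : Type*} [Field F]

/-- `scaleZ c P` represents the point `p` of `V`. -/
def Represents (V : WeierstrassCurve F) (c : F) (p : V.toAffine.Point) (P : Fin 3 → F) : Prop :=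
  V.toJacobian.Nonsingular (scaleZ c P) ∧ Point.toAffine V.toJacobian (scaleZ c P) = p

variable {V : WeierstrassCurve F} {c : F} {p q : V.toAffine.Point} {P Q : Fin 3 → F}

theorem represents_zero : Represents V c 0 ![1, 1, 0] := by
  have : scaleZ c ![1, 1, 0] = ![1, 1, 0] := by simp [scaleZ]
  rw [Represents, this]
  exact ⟨nonsingular_zero, Point.toAffine_zero⟩

variable [DecidableEq F]

theorem Represents.dbl (h : Represents V c p P) :
    Represents V c (p + p) ((scaleCurve c V).toJacobian.dblXYZ P) := by
  rw [Represents, ← dblXYZ_scaleZ, ← add_self]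
  exact ⟨nonsingular_add h.1 h.1, by rw [Point.toAffine_add h.1 h.1, h.2]⟩

theorem Represents.add (hc : c ≠ 0) (hP : Represents V c p P) (hQ : Represents V c q Q)
    (hpq : p ≠ q) : Represents V c (p + q) ((scaleCurve c V).toJacobian.addXYZ P Q) := by
  have hn : ¬scaleZ c P ≈ scaleZ c Q := fun h =>
    hpq (by rw [← hP.2, ← hQ.2, Point.toAffine_of_equiv h])
  have h1 := nonsingular_add hP.1 hQ.1
  have h2 := Point.toAffine_add hP.1 hQ.1
  rw [add_of_not_equiv hn, addXYZ_scaleZ] at h1 h2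
  rw [nonsingular_smul _ hc.isUnit] at h1
  rw [Point.toAffine_smul _ hc.isUnit, hP.2, hQ.2] at h2
  exact ⟨h1, h2⟩

end Represents

section Ladder

variable {A B : Type*} [CommRing A] [CommRing B]

/-- One step of the binary ladder: representatives of `np` and `(n + 1)p` become representatives
of `(2n + b)p` and `(2n + b + 1)p`. -/
noncomputable def ladderStep (U : WeierstrassCurve A) (b : ℕ) (J : (Fin 3 → A) × (Fin 3 → A)) :
    (Fin 3 → A) × (Fin 3 → A) :=
  if b = 0 then (U.toJacobian.dblXYZ J.1, U.toJacobian.addXYZ J.2 J.1)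
  else (U.toJacobian.addXYZ J.2 J.1, U.toJacobian.dblXYZ J.2)

/-- The binary ladder, starting from representatives of `0` and of the point `p`. -/
noncomputable def ladder (U : WeierstrassCurve A) (P : Fin 3 → A) (l : List ℕ) :
    (Fin 3 → A) × (Fin 3 → A) :=
  l.foldl (fun J b => ladderStep U b J) (![1, 1, 0], P)

/-- The number with given binary digits, most significant digit first. -/
def ofBits (l : List ℕ) : ℕ := l.foldl (fun n b => 2 * n + b) 0

theorem ofBits_reverse_digits (m : ℕ) : ofBits (Nat.digits 2 m).reverse = m := by
  conv_rhs => rw [← Nat.ofDigits_digits 2 m]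
  rw [ofBits, List.foldl_reverse, Nat.ofDigits_eq_foldr]
  simp [add_comm]

variable {F : Type*} [Field F] [DecidableEq F]

/-- The invariant holds over any field, even when `p` has small order or a multiple of it is zero:
only `p ≠ 0` is needed to keep the two points distinct. -/
theorem represents_ladder (f : A →+* F) (U : WeierstrassCurve A) (P : Fin 3 → A)
    {V : WeierstrassCurve F} {c : F} (hc : c ≠ 0) (hV : U.map f = scaleCurve c V)
    {p : V.toAffine.Point} (hp : p ≠ 0) (hP : Represents V c p (f ∘ P)) (l : List ℕ)
    (hl : ∀ b ∈ l, b < 2) :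
    Represents V c (ofBits l • p) (f ∘ (ladder U P l).1) ∧
      Represents V c ((ofBits l + 1) • p) (f ∘ (ladder U P l).2) := by
  induction l using List.reverseRecOn with
  | nil =>
    have : f ∘ ![1, 1, 0] = ![1, 1, 0] := by rw [comp_fin3]; simp
    simp only [ofBits, ladder, List.foldl_nil, zero_smul, zero_add, one_smul, this]
    exact ⟨represents_zero, hP⟩
  | append_singleton l b ih =>
    obtain ⟨h1, h2⟩ := ih fun b hb => hl b (by simp [hb])
    have hb := hl b (by simp)
    obtain ⟨n, hn⟩ : ∃ n, n = ofBits l := ⟨_, rfl⟩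
    have hn' : ofBits (l ++ [b]) = 2 * n + b := by simp [ofBits, hn]
    obtain ⟨J, hJ⟩ : ∃ J, J = ladder U P l := ⟨_, rfl⟩
    have hJ' : ladder U P (l ++ [b]) = ladderStep U b J := by simp [ladder, hJ]
    rw [← hn, ← hJ] at h1 h2
    -- `(n + 1)p ≠ np` because `p ≠ 0`.
    have hadd := h2.add hc h1 (by simpa [add_smul] using hp)
    have hd1 := h1.dbl
    have hd2 := h2.dbl
    rw [← hV] at hadd hd1 hd2
    have e1 : f ∘ U.toJacobian.dblXYZ J.1 = (U.map f).toJacobian.dblXYZ (f ∘ J.1) :=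
      (map_dblXYZ f J.1).symm
    have e2 : f ∘ U.toJacobian.dblXYZ J.2 = (U.map f).toJacobian.dblXYZ (f ∘ J.2) :=
      (map_dblXYZ f J.2).symm
    have e3 : f ∘ U.toJacobian.addXYZ J.2 J.1 =
      (U.map f).toJacobian.addXYZ (f ∘ J.2) (f ∘ J.1) := (map_addXYZ f J.2 J.1).symm
    rw [hn', hJ']
    obtain rfl | rfl : b = 0 ∨ b = 1 := by omega
    · simp only [ladderStep, if_pos, e1, e3]
      refine ⟨?_, ?_⟩
      · convert! hd1 using 1
        rw [← add_smul]; congr 1; ring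
      · convert! hadd using 1
        rw [← add_smul]; congr 1; ring
    · simp only [ladderStep, one_ne_zero, if_false, e2, e3]
      refine ⟨?_, ?_⟩
      · convert! hadd using 1
        rw [← add_smul]; congr 1; ring
      · convert! hd2 using 1
        rw [← add_smul]; congr 1; ring

end Ladder

/-! ### Primitivity of the ladder -/

/-- The image of an integral point representative in a commutative ring. -/
abbrev castVec (A : Type*) [CommRing A] (P : Fin 3 → ℤ) : Fin 3 → A := Int.castRingHom A ∘ P

/-- This is the cusp, to which the integral curve reduces at primes dividing `d(Q)`. -/
theorem nonsingular_scaleCurve_zero {F : Type*} [Field F] {V : WeierstrassCurve F} {P : Fin 3 → F} :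
    (scaleCurve 0 V).toJacobian.Nonsingular P ↔ P 1 ^ 2 = P 0 ^ 3 ∧ (P 0 ≠ 0 ∨ P 1 ≠ 0) := by
  rw [nonsingular_iff, equation_iff]
  simp only [scaleCurve, zero_mul, ne_eq, OfNat.ofNat_ne_zero, not_false_eq_true, zero_pow, mul_zero,
    add_zero, sub_eq_zero (a := P 1 ^ 2)]
  refine and_congr_right fun h => ?_
  constructor
  · rintro h'
    by_contra! hn
    simp [hn] at h'
  · intro h'
    have hx : P 0 ≠ 0 := by
      rintro hx
      rw [hx] at h
      simp [hx] at h h'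
      exact h' h
    have hy : P 1 ≠ 0 := by
      rintro hy
      rw [hy] at h
      simp at h
      exact hx (by simpa using h.symm)
    by_contra! hn
    obtain ⟨h1, h2, -⟩ := hn
    -- The partial derivatives `3X²` and `2Y` cannot both vanish with `X` and `Y` nonzero, since 2
    -- and 3 are not both zero in a field.
    have h3 : (3 : F) = 0 := by simpa [hx] using h1
    have h2 : (2 : F) = 0 := by
      have : 2 * P 1 = 0 := by linear_combination h2
      simpa [hy] using this
    have : (1 : F) = 0 := by linear_combination h3 - h2
    exact one_ne_zero this

variable {W : WeierstrassCurve ℤ} {x y : ℚ}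
  {h : (W.map (Int.castRingHom ℚ)).toAffine.Nonsingular x y}

/-- The Jacobian coordinates `[α(Q) : β(Q) : d(Q)]`. -/
def jacobianCoords (Q : Point W) : Fin 3 → ℤ := ![alpha Q, beta Q, denom Q]

theorem coords_spec (h : (W.map (Int.castRingHom ℚ)).toAffine.Nonsingular x y) :
    1 ≤ denom (.some x y h : Point W) ∧
      IsCoprime (alpha (.some x y h : Point W)) (denom (.some x y h : Point W)) ∧
      IsCoprime (beta (.some x y h : Point W)) (denom (.some x y h : Point W)) ∧
      x = alpha (.some x y h : Point W) / denom (.some x y h : Point W) ^ 2 ∧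
      y = beta (.some x y h : Point W) / denom (.some x y h : Point W) ^ 3 :=
  (coords_unique h _ _ _).mpr ⟨rfl, rfl, rfl⟩

theorem nonsingular_jacobianCoords_rat
    (h : (W.map (Int.castRingHom ℚ)).toAffine.Nonsingular x y) :
    (W.map (Int.castRingHom ℚ)).toJacobian.Nonsingular
      (castVec ℚ (jacobianCoords (.some x y h : Point W))) := by
  obtain ⟨hd, -, -, hx, hy⟩ := coords_spec h
  have hd0 : castVec ℚ (jacobianCoords (.some x y h : Point W)) 2 ≠ 0 := by
    simp [jacobianCoords]; omega
  rw [nonsingular_of_Z_ne_zero hd0]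
  simp only [castVec, jacobianCoords, Function.comp_apply, Matrix.cons_val, eq_intCast]
  rw [← hx, ← hy]
  exact h

theorem equation_jacobianCoords (h : (W.map (Int.castRingHom ℚ)).toAffine.Nonsingular x y) :
    W.toJacobian.Equation (jacobianCoords (.some x y h : Point W)) :=
  (map_equation (W' := W.toJacobian) (f := Int.castRingHom ℚ) Int.cast_injective _).mp
    (nonsingular_jacobianCoords_rat h).1

/-- A point reduces to a nonsingular point modulo every prime not dividing the discriminant or
not dividing its denominator. -/
theorem nonsingular_jacobianCoords_zmod (ℓ : ℕ) [Fact ℓ.Prime]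
    (h : (W.map (Int.castRingHom ℚ)).toAffine.Nonsingular x y)
    (hΔ : (ℓ : ℤ) ∣ W.Δ → ReducesToNonsingular (.some x y h : Point W) ℓ)
    (hd : ((denom (.some x y h : Point W) : ℤ) : ZMod ℓ) ≠ 0) :
    (W.map (Int.castRingHom (ZMod ℓ))).toJacobian.Nonsingular
      (castVec (ZMod ℓ) (jacobianCoords (.some x y h : Point W))) := by
  by_cases hℓ : (ℓ : ℤ) ∣ W.Δ
  · have e : castVec (ZMod ℓ) (jacobianCoords (.some x y h : Point W)) =
        ![(alpha (.some x y h : Point W) : ZMod ℓ), (beta (.some x y h : Point W) : ZMod ℓ),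
          (denom (.some x y h : Point W) : ZMod ℓ)] := comp_fin3 _ _ _ _
    rw [e]
    exact hΔ hℓ
  · have heq := Equation.map (W' := W.toJacobian) (Int.castRingHom (ZMod ℓ))
      (equation_jacobianCoords h)
    have hd0 : castVec (ZMod ℓ) (jacobianCoords (.some x y h : Point W)) 2 ≠ 0 := by
      simpa [jacobianCoords] using hd
    rw [nonsingular_of_Z_ne_zero hd0]
    refine (Affine.equation_iff_nonsingular_of_Δ_ne_zero ?_).mp
      ((equation_of_Z_ne_zero hd0).mp heq)
    change (W.map (Int.castRingHom (ZMod ℓ))).Δ ≠ 0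
    rwa [map_Δ, eq_intCast, Ne, ZMod.intCast_zmod_eq_zero_iff_dvd]

/-- The integral curve on which `(α(Q), β(Q))` is a point. -/
def integralCurve (Q : Point W) : WeierstrassCurve ℤ := scaleCurve (denom Q) W

/-- The coordinates that the binary ladder computes. -/
noncomputable def ladderCoords (Q : Point W) (m : ℕ) : Fin 3 → ℤ :=
  (ladder (integralCurve Q) ![alpha Q, beta Q, 1] (Nat.digits 2 m).reverse).1

/-- `V` and `c` are kept free for two uses: `c = d(Q)` with `V` the image of `W`, over `ℚ` or modulo
`ℓ ∤ d(Q)`; and `c = 1` with `V` the cusp, when `ℓ ∣ d(Q)` and the former scaling is not invertible.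
-/
theorem represents_ladderCoords (Q : Point W) {F : Type*} [Field F] [DecidableEq F]
    {V : WeierstrassCurve F} {c : F} (hc : c ≠ 0)
    (hV : (integralCurve Q).map (Int.castRingHom F) = scaleCurve c V)
    (hQ : V.toJacobian.Nonsingular ![(alpha Q : F), (beta Q : F), c]) (m : ℕ) :
    Represents V c (m • Point.toAffine V.toJacobian ![(alpha Q : F), (beta Q : F), c])
      (castVec F (ladderCoords Q m)) := by
  have e : scaleZ c (castVec F ![alpha Q, beta Q, 1]) = ![(alpha Q : F), (beta Q : F), c] := by
    simp [scaleZ]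
  have := represents_ladder (Int.castRingHom F) (integralCurve Q) ![alpha Q, beta Q, 1] hc hV
    (p := Point.toAffine V.toJacobian ![(alpha Q : F), (beta Q : F), c])
    (by
      rw [Point.toAffine_of_Z_ne_zero hQ (by simpa using hc)]
      exact Affine.Point.some_ne_zero _)
    ⟨by rwa [e], by rw [e]⟩ (Nat.digits 2 m).reverse
    (fun b hb => Nat.digits_lt_base one_lt_two (List.mem_reverse.mp hb))
  rw [ofBits_reverse_digits] at this
  exact this.1

/-- The coordinates computed by the ladder have no common prime factor with the denominator. -/
theorem ladderCoords_zmod_ne_zero (ℓ : ℕ) [Fact ℓ.Prime]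
    (h : (W.map (Int.castRingHom ℚ)).toAffine.Nonsingular x y)
    (hΔ : (ℓ : ℤ) ∣ W.Δ → ReducesToNonsingular (.some x y h : Point W) ℓ) (m : ℕ)
    (hz : ((denom (.some x y h : Point W) * ladderCoords (.some x y h : Point W) m 2 : ℤ) :
      ZMod ℓ) = 0) :
    ((ladderCoords (.some x y h : Point W) m 0 : ℤ) : ZMod ℓ) ≠ 0 ∧
      ((ladderCoords (.some x y h : Point W) m 1 : ℤ) : ZMod ℓ) ≠ 0 := by
  obtain ⟨Q, hQ⟩ : ∃ Q : Point W, Q = .some x y h := ⟨_, rfl⟩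
  by_cases hd : ((denom Q : ℤ) : ZMod ℓ) = 0
  · obtain ⟨V, hV⟩ : ∃ V, V = scaleCurve 0 (W.map (Int.castRingHom (ZMod ℓ))) := ⟨_, rfl⟩
    have hV' : (integralCurve Q).map (Int.castRingHom (ZMod ℓ)) = scaleCurve 1 V := by
      rw [integralCurve, scaleCurve_map, eq_intCast, hd, hV]
      simp [scaleCurve]
    have hns : V.toJacobian.Nonsingular ![(alpha Q : ZMod ℓ), (beta Q : ZMod ℓ), 1] := by
      rw [hV, nonsingular_scaleCurve_zero]
      have heq := (equation_iff _).mp (Equation.map (W' := W.toJacobian)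
        (Int.castRingHom (ZMod ℓ)) (equation_jacobianCoords h))
      rw [← hQ] at heq
      simp [jacobianCoords, hd] at heq
      -- `α(Q)` is coprime to `d(Q)`, hence nonzero modulo `ℓ`: the start avoids the cusp.
      refine ⟨by simpa [sub_eq_zero] using heq, .inl ?_⟩
      obtain ⟨-, ⟨u, v, huv⟩, -⟩ := coords_spec h
      rw [← hQ] at huv
      intro h0
      have := congrArg (Int.cast : ℤ → ZMod ℓ) huv
      simp at h0
      simp [hd, h0] at this
    have := (represents_ladderCoords Q one_ne_zero hV' hns m).1
    rw [hV, nonsingular_scaleCurve_zero] at this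
    simp only [scaleZ, castVec, Function.comp_apply, Matrix.cons_val, eq_intCast, hQ] at this
    -- On the cuspidal curve `Y² = X³`, if one of `X` and `Y` vanishes then so does the other, and
    -- the point is singular.
    obtain ⟨h1, h2⟩ := this
    constructor
    · intro h0
      simp [h0] at h1 h2
      exact h2 h1
    · intro h0
      simp [h0] at h1 h2
      exact h2 (by simpa using h1.symm)
  · have hns := nonsingular_jacobianCoords_zmod ℓ h hΔ (hQ ▸ hd)
    rw [← hQ] at hns
    have e : castVec (ZMod ℓ) (jacobianCoords Q) =
        ![(alpha Q : ZMod ℓ), (beta Q : ZMod ℓ), (denom Q : ZMod ℓ)] := comp_fin3 _ _ _ _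
    rw [e] at hns
    have := (represents_ladderCoords Q hd
      (by rw [integralCurve, scaleCurve_map, eq_intCast]) hns m).1
    have hz' : scaleZ (denom Q : ZMod ℓ) (castVec (ZMod ℓ) (ladderCoords Q m)) 2 = 0 := by
      simpa [scaleZ, hQ] using hz
    -- A nonsingular representative with `Z = 0` is a point at infinity, where `X` and `Y` are
    -- nonzero.
    exact ⟨by simpa [scaleZ, hQ] using X_ne_zero_of_Z_eq_zero this hz',
      by simpa [scaleZ, hQ] using Y_ne_zero_of_Z_eq_zero this hz'⟩

theorem isCoprime_of_forall_zmod {a b : ℤ}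
    (h : ∀ ℓ : ℕ, ℓ.Prime → (b : ZMod ℓ) = 0 → (a : ZMod ℓ) ≠ 0) : IsCoprime a b := by
  rw [Int.isCoprime_iff_gcd_eq_one]
  by_contra hn
  obtain ⟨ℓ, hℓ, hd⟩ := Nat.exists_prime_and_dvd hn
  have hd' : (ℓ : ℤ) ∣ Int.gcd a b := Int.natCast_dvd_natCast.mpr hd
  refine h ℓ hℓ ?_ ?_
  · exact (ZMod.intCast_zmod_eq_zero_iff_dvd _ _).mpr (hd'.trans (Int.gcd_dvd_right _ _))
  · exact (ZMod.intCast_zmod_eq_zero_iff_dvd _ _).mpr (hd'.trans (Int.gcd_dvd_left _ _))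

/-- The binary ladder computes `α(mQ)` and, up to a common sign, `β(mQ)` and `d(mQ) / d(Q)`. -/
theorem ladderCoords_spec (Q : Point W)
    (hQ : ∀ ℓ : ℕ, ℓ.Prime → (ℓ : ℤ) ∣ W.Δ → ReducesToNonsingular Q ℓ) (m : ℕ) (hm : m • Q ≠ 0) :
    ∃ ε : ℤ, (ε = 1 ∨ ε = -1) ∧ ladderCoords Q m 0 = alpha (m • Q) ∧
      ladderCoords Q m 1 = ε * beta (m • Q) ∧
      denom Q * ladderCoords Q m 2 = ε * denom (m • Q) := by
  rcases Q with _ | ⟨x, y, h⟩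
  · exact absurd (nsmul_zero m : m • (0 : Point W) = 0) hm
  obtain ⟨Q, hQ'⟩ : ∃ Q : Point W, Q = .some x y h := ⟨_, rfl⟩
  have hc1 : IsCoprime (ladderCoords (.some x y h : Point W) m 0)
      (denom (.some x y h : Point W) * ladderCoords (.some x y h : Point W) m 2) :=
    isCoprime_of_forall_zmod fun ℓ hℓ hz =>
      haveI := Fact.mk hℓ; (ladderCoords_zmod_ne_zero ℓ h (hQ ℓ hℓ) m hz).1
  have hc2 : IsCoprime (ladderCoords (.some x y h : Point W) m 1)
      (denom (.some x y h : Point W) * ladderCoords (.some x y h : Point W) m 2) :=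
    isCoprime_of_forall_zmod fun ℓ hℓ hz =>
      haveI := Fact.mk hℓ; (ladderCoords_zmod_ne_zero ℓ h (hQ ℓ hℓ) m hz).2
  obtain ⟨hd, -, -, hx, hy⟩ := coords_spec h
  have hns := nonsingular_jacobianCoords_rat h
  rw [← hQ'] at hc1 hc2 hd hx hy hns hm ⊢
  have e : castVec ℚ (jacobianCoords Q) = ![(alpha Q : ℚ), (beta Q : ℚ), (denom Q : ℚ)] :=
    comp_fin3 _ _ _ _
  rw [e] at hns
  have hd0 : (denom Q : ℚ) ≠ 0 := by exact_mod_cast (by omega : denom Q ≠ 0)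
  obtain ⟨h1, h2⟩ := represents_ladderCoords Q hd0
    (by rw [integralCurve, scaleCurve_map, eq_intCast]) hns m
  have hQ'' : Point.toAffine (W.map (Int.castRingHom ℚ)).toJacobian
      ![(alpha Q : ℚ), (beta Q : ℚ), (denom Q : ℚ)] = Q := by
    refine (Point.toAffine_of_Z_ne_zero hns (by simpa using hd0)).trans (Eq.trans ?_ hQ'.symm)
    rw [Affine.Point.some.injEq]
    exact ⟨hx.symm, hy.symm⟩
  rw [hQ''] at h2
  have hz : scaleZ (denom Q : ℚ) (castVec ℚ (ladderCoords Q m)) 2 ≠ 0 := fun hz =>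
    hm (by rw [← h2]; exact Point.toAffine_of_Z_eq_zero hz)
  rw [Point.toAffine_of_Z_ne_zero h1 hz] at h2
  rw [← h2]
  obtain ⟨X, hX⟩ : ∃ X, X = ladderCoords Q m 0 := ⟨_, rfl⟩
  obtain ⟨Y, hY⟩ : ∃ Y, Y = ladderCoords Q m 1 := ⟨_, rfl⟩
  obtain ⟨Z, hZ⟩ : ∃ Z, Z = denom Q * ladderCoords Q m 2 := ⟨_, rfl⟩
  have hZ0 : Z ≠ 0 := by
    rintro h0
    apply hz
    rw [h0] at hZ
    simp only [scaleZ, castVec, Function.comp_apply, Matrix.cons_val, eq_intCast]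
    exact_mod_cast hZ.symm
  -- `ε` is the sign of `Z`. Passing to `(X, εY, εZ)` leaves the point unchanged and makes the
  -- denominator positive, so `coords_unique` applies.
  obtain ⟨ε, hε, hεZ⟩ : ∃ ε : ℤ, (ε = 1 ∨ ε = -1) ∧ 1 ≤ ε * Z := by
    rcases lt_or_gt_of_ne hZ0 with hneg | hpos
    · exact ⟨-1, .inr rfl, by omega⟩
    · exact ⟨1, .inl rfl, by omega⟩
  have hε2 : ε * ε = 1 := by rcases hε with rfl | rfl <;> rfl
  have hεu : IsUnit ε := IsUnit.of_mul_eq_one _ hε2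
  refine ⟨ε, hε, ?_⟩
  rw [← hX, ← hZ] at hc1
  rw [← hY, ← hZ] at hc2
  have hZq : (Z : ℚ) = denom Q * (ladderCoords Q m 2 : ℚ) := by rw [hZ]; push_cast; rfl
  have hZq0 : (Z : ℚ) ≠ 0 := by exact_mod_cast hZ0
  have hεq : (ε : ℚ) * ε = 1 := by exact_mod_cast hε2
  have hεq0 : (ε : ℚ) ≠ 0 := fun h => by simp [h] at hεq
  obtain ⟨r1, r2, r3⟩ := (coords_unique ((nonsingular_of_Z_ne_zero hz).mp h1) X (ε * Y) (ε * Z)).mp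
    ⟨hεZ, (isCoprime_mul_unit_left_right hεu _ _).mpr hc1,
      (isCoprime_mul_unit_left hεu _ _).mpr hc2, by
        simp only [scaleZ, castVec, Function.comp_apply, Matrix.cons_val, eq_intCast, ← hX, ← hZq]
        push_cast
        rw [mul_pow, pow_two (ε : ℚ), hεq, one_mul], by
        simp only [scaleZ, castVec, Function.comp_apply, Matrix.cons_val, eq_intCast, ← hY, ← hZq]
        push_cast
        field_simp
        linear_combination (Y : ℚ) * hεq⟩
  rw [← hX, ← hY, ← hZ]
  refine ⟨r1, ?_, ?_⟩
  · rw [← r2, ← mul_assoc, hε2, one_mul]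
  · rw [← r3, ← mul_assoc, hε2, one_mul]

end DivPoly

namespace DivPoly

open WeierstrassCurve WeierstrassCurve.Jacobian

/-! ### The ladder as a program -/

section Encoding

variable {A : Type*}

/-- A state of the ladder: two point representatives, the coefficients of the curve, and an
auxiliary number. -/
def encode (J : (Fin 3 → A) × (Fin 3 → A)) (U : WeierstrassCurve A) (d : A) : Fin 12 → A :=
  ![J.1 0, J.1 1, J.1 2, J.2 0, J.2 1, J.2 2, U.a₁, U.a₂, U.a₃, U.a₄, U.a₆, d]

/-- The curve in a state of the ladder. -/
def curveOf (v : Fin 12 → A) : WeierstrassCurve A := ⟨v 6, v 7, v 8, v 9, v 10⟩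

/-- The point representatives in a state of the ladder. -/
def pairOf (v : Fin 12 → A) : (Fin 3 → A) × (Fin 3 → A) :=
  (![v 0, v 1, v 2], ![v 3, v 4, v 5])

theorem curveOf_encode (J : (Fin 3 → A) × (Fin 3 → A)) (U : WeierstrassCurve A) (d : A) :
    curveOf (encode J U d) = U := rfl

theorem pairOf_encode (J : (Fin 3 → A) × (Fin 3 → A)) (U : WeierstrassCurve A) (d : A) :
    pairOf (encode J U d) = J :=
  Prod.ext (fin3_def J.1) (fin3_def J.2)

theorem encode_eleven (J : (Fin 3 → A) × (Fin 3 → A)) (U : WeierstrassCurve A) (d : A) :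
    encode J U d 11 = d := rfl

variable [CommRing A]

/-- A step of the ladder on its states. -/
noncomputable def stepVec (b : ℕ) (v : Fin 12 → A) : Fin 12 → A :=
  encode (ladderStep (curveOf v) b (pairOf v)) (curveOf v) (v 11)

/-- The initial state of the ladder for the point `[v 0 : v 1 : v 11]`. -/
def initVec (v : Fin 12 → A) : Fin 12 → A :=
  encode (![1, 1, 0], ![v 0, v 1, 1]) (scaleCurve (v 11) (curveOf v)) (v 11)

/-- The multiplication of the third coordinate by the auxiliary number. -/
def finalVec (v : Fin 12 → A) : Fin 12 → A :=
  encode (![v 0, v 1, v 11 * v 2], ![v 3, v 4, v 5]) (curveOf v) (v 11)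

theorem foldl_stepVec (U : WeierstrassCurve A) (d : A) (l : List ℕ)
    (J : (Fin 3 → A) × (Fin 3 → A)) :
    l.foldl (fun w b => if b = 0 then stepVec 0 w else stepVec 1 w) (encode J U d) =
      encode (l.foldl (fun J b => ladderStep U b J) J) U d := by
  induction l generalizing J with
  | nil => rfl
  | cons b l ih =>
    rw [List.foldl_cons, List.foldl_cons, ← ih]
    congr 1
    simp only [stepVec, curveOf_encode, pairOf_encode, encode_eleven]
    by_cases hb : b = 0 <;> simp [hb, ladderStep]

end Encoding

theorem modTransform_initVec : ModTransform (initVec (A := ℤ)) := by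
  refine modTransform_of_modComputable fun i => ?_
  fin_cases i <;> simp [initVec, encode, scaleCurve, curveOf] <;>
    repeat' first
      | exact ModComputable.coord _
      | exact ModComputable.const _
      | apply ModComputable.mul
      | apply ModComputable.pow

/-! ### The Jacobian doubling and addition formulas as residue computations. -/

section Formulas

variable {N : ℕ} {U : (Fin N → ℤ) → WeierstrassCurve ℤ} {P Q : (Fin N → ℤ) → Fin 3 → ℤ}

namespace ModComputable

theorem negY (h₁ : ModComputable fun v => (U v).a₁) (h₃ : ModComputable fun v => (U v).a₃)
    (hP : ∀ i, ModComputable fun v => P v i) :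
    ModComputable fun v => (U v).toJacobian.negY (P v) :=
  ((hP 1).neg.sub ((h₁.mul (hP 0)).mul (hP 2))).sub (h₃.mul ((hP 2).pow 3))

theorem vec3 {f g h : (Fin N → ℤ) → ℤ} (hf : ModComputable f) (hg : ModComputable g)
    (hh : ModComputable h) (i : Fin 3) : ModComputable fun v => (![f v, g v, h v] : Fin 3 → ℤ) i := by
  fin_cases i
  exacts [hf, hg, hh]

theorem dblXYZ (h₁ : ModComputable fun v => (U v).a₁) (h₂ : ModComputable fun v => (U v).a₂)
    (h₃ : ModComputable fun v => (U v).a₃) (h₄ : ModComputable fun v => (U v).a₄)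
    (hP : ∀ i, ModComputable fun v => P v i) (i : Fin 3) :
    ModComputable fun v => (U v).toJacobian.dblXYZ (P v) i := by
  have hY : ModComputable fun v => P v 1 - (U v).toJacobian.negY (P v) := (hP 1).sub (negY h₁ h₃ hP)
  have hU : ModComputable fun v => (U v).toJacobian.dblU (P v) := by
    simp only [dblU_eq]
    exact ((h₁.mul (hP 1)).mul (hP 2)).sub (((((const 3).mul ((hP 0).pow 2))).add
      ((((const 2).mul h₂).mul (hP 0)).mul ((hP 2).pow 2))).add (h₄.mul ((hP 2).pow 4)))
  have hX : ModComputable fun v => (U v).toJacobian.dblX (P v) :=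
    (((hU.pow 2).sub (((h₁.mul hU).mul (hP 2)).mul hY)).sub
      ((h₂.mul ((hP 2).pow 2)).mul (hY.pow 2))).sub (((const 2).mul (hP 0)).mul (hY.pow 2))
  have hZ : ModComputable fun v => (U v).toJacobian.dblZ (P v) := (hP 2).mul hY
  have hN : ModComputable fun v => (U v).toJacobian.negDblY (P v) :=
    (hU.neg.mul (hX.sub ((hP 0).mul (hY.pow 2)))).add ((hP 1).mul (hY.pow 3))
  exact vec3 hX (negY h₁ h₃ (vec3 hX hN hZ)) hZ i

theorem addXYZ (h₁ : ModComputable fun v => (U v).a₁) (h₂ : ModComputable fun v => (U v).a₂)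
    (h₃ : ModComputable fun v => (U v).a₃) (h₄ : ModComputable fun v => (U v).a₄)
    (h₆ : ModComputable fun v => (U v).a₆) (hP : ∀ i, ModComputable fun v => P v i)
    (hQ : ∀ i, ModComputable fun v => Q v i) (i : Fin 3) :
    ModComputable fun v => (U v).toJacobian.addXYZ (P v) (Q v) i := by
  have hZ : ModComputable fun v => addZ (P v) (Q v) :=
    ((hP 0).mul ((hQ 2).pow 2)).sub ((hQ 0).mul ((hP 2).pow 2))
  have hX : ModComputable fun v => (U v).toJacobian.addX (P v) (Q v) := by
    unfold addX
    repeat' first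
      | assumption
      | exact hP _
      | exact hQ _
      | exact const _
      | apply sub
      | apply add
      | apply mul
      | apply pow
  have hN : ModComputable fun v => (U v).toJacobian.negAddY (P v) (Q v) := by
    unfold negAddY
    repeat' first
      | assumption
      | exact hP _
      | exact hQ _
      | exact const _
      | apply sub
      | apply add
      | apply mul
      | apply pow
      | apply neg
  exact vec3 hX (negY h₁ h₃ (vec3 hX hN hZ)) hZ i

end ModComputable

end Formulas

theorem modComputable_encode {J : (Fin 12 → ℤ) → (Fin 3 → ℤ) × (Fin 3 → ℤ)}
    (h₁ : ∀ i, ModComputable fun v => (J v).1 i) (h₂ : ∀ i, ModComputable fun v => (J v).2 i)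
    (i : Fin 12) : ModComputable fun v => encode (J v) (curveOf v) (v 11) i := by
  fin_cases i
  exacts [h₁ 0, h₁ 1, h₁ 2, h₂ 0, h₂ 1, h₂ 2, .coord 6, .coord 7, .coord 8, .coord 9, .coord 10,
    .coord 11]

theorem modTransform_finalVec : ModTransform (finalVec (A := ℤ)) :=
  modTransform_of_modComputable (modComputable_encode
    (.vec3 (.coord 0) (.coord 1) (.mul (.coord 11) (.coord 2)))
    (.vec3 (.coord 3) (.coord 4) (.coord 5)))

theorem modTransform_stepVec (b : ℕ) : ModTransform (stepVec (A := ℤ) b) := by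
  have hP : ∀ i, ModComputable fun v : Fin 12 → ℤ => (pairOf v).1 i :=
    .vec3 (.coord 0) (.coord 1) (.coord 2)
  have hQ : ∀ i, ModComputable fun v : Fin 12 → ℤ => (pairOf v).2 i :=
    .vec3 (.coord 3) (.coord 4) (.coord 5)
  have hadd := ModComputable.addXYZ (U := curveOf) (.coord 6) (.coord 7) (.coord 8) (.coord 9)
    (.coord 10) hQ hP
  refine modTransform_of_modComputable (modComputable_encode ?_ ?_) <;>
    by_cases hb : b = 0 <;> simp only [ladderStep, hb, if_true, if_false]
  exacts [.dblXYZ (.coord 6) (.coord 7) (.coord 8) (.coord 9) hP, hadd, hadd,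
    .dblXYZ (.coord 6) (.coord 7) (.coord 8) (.coord 9) hQ]

/-- The vector of the coefficients of the curve and of the coordinates of the point. -/
def inputVec {W : WeierstrassCurve ℤ} (Q : Point W) : Fin 12 → ℤ :=
  encode (![alpha Q, beta Q, 0], ![0, 0, 0]) W (denom Q)

/-- In `bits` the whole list is coerced to `List ℤ` and the mapped function is then the identity;
here the cast is moved into the map. -/
theorem bits_eq (m : ℕ) : bits m = (Nat.digits 2 m).reverse.map (fun b : ℕ => (b : ℤ)) := by
  rw [bits, List.map_id']
  exact bind_pure_comp _ _

/-- Reading the input. -/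
theorem exists_prog_input : ∃ P : Prog, ∀ W : WeierstrassCurve ℤ, ∃ C : ℕ,
    ∀ (Q : Point W) (R m : ℕ), 1 ≤ R → ∃ s τ, Exec P (State.init (inputOf W Q R m)) s τ ∧
      s.Holds R (inputVec Q) ∧ s.reg (12 + 3) = 1 ∧
      s.input = (Nat.digits 2 m).reverse.map (fun b : ℕ => (b : ℤ)) ∧ τ ≤ C * mulCost R := by
  -- This is the constant of `Op.cost_le_of_len_le` for reducing an integer of length `n` modulo
  -- `R`. The coefficients are read unreduced, so the total depends on the curve.
  obtain ⟨k, hk⟩ : ∃ k : ℕ → ℕ, ∀ n, k n = (n + 2) * ((n + 2).size + 1) ^ 2 := ⟨_, fun _ => rfl⟩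
  refine ⟨.seq (.read 6) (.seq (.read 7) (.seq (.read 8) (.seq (.read 9) (.seq (.read 10)
    (.seq (.read 12) (.seq (.read 0) (.seq (.read 1) (.seq (.read 11) (.seq (.arith .mod 6 6 12)
    (.seq (.arith .mod 7 7 12) (.seq (.arith .mod 8 8 12) (.seq (.arith .mod 9 9 12)
    (.seq (.arith .mod 10 10 12) (.const 15 1)))))))))))))), fun W => ?_⟩
  refine ⟨len W.a₁ + len W.a₂ + len W.a₃ + len W.a₄ + len W.a₆ + 8 + k (len W.a₁) + k (len W.a₂)
    + k (len W.a₃) + k (len W.a₄) + k (len W.a₆) + 2, fun Q R m hR => ?_⟩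
  have hM := one_le_mulCost hR
  have hmod (a : ℤ) : Op.mod.cost a R ≤ k (len a) * mulCost R := by
    rw [hk]
    refine Op.cost_le_of_len_le _ hR ?_
    have := len_natCast_le hR
    have := one_le_size hR
    nlinarith [one_le_len a]
  refine ⟨_, _, .seq (.read_cons _ _ _ _) (.seq (.read_cons _ _ _ _) (.seq (.read_cons _ _ _ _)
    (.seq (.read_cons _ _ _ _) (.seq (.read_cons _ _ _ _) (.seq (.read_cons _ _ _ _)
    (.seq (.read_cons _ _ _ _) (.seq (.read_cons _ _ _ _) (.seq (.read_cons _ _ _ _)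
    (.seq (.arith _ _ _ _ _) (.seq (.arith _ _ _ _ _) (.seq (.arith _ _ _ _ _)
    (.seq (.arith _ _ _ _ _) (.seq (.arith _ _ _ _ _) (.const _ _ _)))))))))))))),
    ⟨?_, ?_⟩, ?_, ?_, ?_⟩
  · simp [State.set]
  · intro i
    fin_cases i <;> simp [State.set, Op.eval, inputVec, encode]
  · simp [State.set]
  · rw [← bits_eq]
    rfl
  · simp only [State.set, Function.update_apply, Nat.reduceEqDiff, if_false,
      if_true, OfNat.ofNat_ne_zero, OfNat.ofNat_ne_one]
    have hS := size_le_mulCost hR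
    have h1 := len_natCast_le hR
    have h2 := len_emod_le (alpha Q) hR
    have h3 := len_emod_le (beta Q) hR
    have h4 := len_emod_le (denom Q) hR
    have h5 := hmod W.a₁
    have h6 := hmod W.a₂
    have h7 := hmod W.a₃
    have h8 := hmod W.a₄
    have h9 := hmod W.a₆
    have hlen (a : ℤ) : len a ≤ len a * mulCost R := Nat.le_mul_of_pos_right _ hM
    have g1 := hlen W.a₁
    have g2 := hlen W.a₂
    have g3 := hlen W.a₃
    have g4 := hlen W.a₄
    have g5 := hlen W.a₆
    have len1 : len 1 = 2 := rfl
    simp only [add_mul]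
    omega

/-! ### From bit lengths to the bound `X (log X)²`. -/

theorem length_digits_le (m : ℕ) (hm : m ≠ 0) : (Nat.digits 2 m).length ≤ m.size := by
  rw [Nat.length_digits 2 m one_lt_two hm]
  exact Nat.lt_size.mpr (Nat.pow_log_le_self 2 hm)

/-- Both `(n.size - 1) * log 2` and `log 2` are at most `log n`, and `log 2 > 1/2`. -/
theorem size_le_log {n : ℕ} (hn : 2 ≤ n) : (n.size : ℝ) ≤ 4 * Real.log n := by
  have h1 : 1 ≤ n.size := one_le_size (by omega)
  have h2 : 2 ^ (n.size - 1) ≤ n := Nat.lt_size.mp (by omega)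
  have h3 : ((n.size - 1 : ℕ) : ℝ) * Real.log 2 ≤ Real.log n := by
    rw [← Real.log_pow]
    exact Real.log_le_log (by positivity) (by exact_mod_cast h2)
  have h4 : Real.log 2 ≤ Real.log n := Real.log_le_log two_pos (by exact_mod_cast hn)
  have h5 := Real.log_two_gt_d9
  rw [Nat.cast_sub h1] at h3
  have h6 : (0 : ℝ) ≤ n.size := Nat.cast_nonneg _
  push_cast at h3
  nlinarith

theorem mulCost_mul_size_le {R m : ℕ} (hR : 1 ≤ R) (hm : 2 ≤ m) :
    ((mulCost R * m.size : ℕ) : ℝ) ≤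
      16 * ((R.size * m.size : ℕ) : ℝ) * Real.log ((R.size * m.size : ℕ) : ℝ) ^ 2 := by
  have hn := one_le_size hR
  have hs : 2 ≤ m.size := Nat.lt_size.mpr (by simpa using hm)
  -- `m ≥ 2` keeps the logarithm away from zero even when `R = 1`.
  have hX : 2 ≤ R.size * m.size := by nlinarith
  have h1 : R.size.size ≤ (R.size * m.size).size :=
    Nat.size_le_size (Nat.le_mul_of_pos_right _ (by omega))
  have h2 : (R.size.size : ℝ) ≤ 4 * Real.log ((R.size * m.size : ℕ) : ℝ) :=
    le_trans (by exact_mod_cast h1) (size_le_log hX)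
  calc ((mulCost R * m.size : ℕ) : ℝ) = ((R.size * m.size : ℕ) : ℝ) * (R.size.size : ℝ) ^ 2 := by
        rw [mulCost]; push_cast; ring
    _ ≤ ((R.size * m.size : ℕ) : ℝ) * (4 * Real.log ((R.size * m.size : ℕ) : ℝ)) ^ 2 := by gcongr
    _ = _ := by ring

end DivPoly

theorem mainTheorem4 :
    ∃ (P : DivPoly.Prog) (k : ℕ),
      ∀ W : WeierstrassCurve ℤ, W.Δ ≠ 0 →
        ∃ C : ℝ, ∀ (Q : DivPoly.Point W) (R m : ℕ),
          (∀ ℓ : ℕ, ℓ.Prime → (ℓ : ℤ) ∣ W.Δ → DivPoly.ReducesToNonsingular Q ℓ) →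
          1 ≤ R → Odd R → 2 ≤ m → m • Q ≠ 0 →
          ∃ (s : DivPoly.State) (t : ℕ) (ε : ℤ),
            DivPoly.Exec P (DivPoly.State.init (DivPoly.inputOf W Q R m)) s t ∧
            (ε = 1 ∨ ε = -1) ∧
            s.reg 0 = DivPoly.alpha (m • Q) % R ∧
            s.reg 1 = (ε * DivPoly.beta (m • Q)) % R ∧
            s.reg 2 = (ε * DivPoly.denom (m • Q)) % R ∧
            (t : ℝ) ≤ C * ((Nat.size R * Nat.size m : ℕ) : ℝ) *
              Real.log ((Nat.size R * Nat.size m : ℕ) : ℝ) ^ k := by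
  open DivPoly in
  obtain ⟨P₁, h₁⟩ := exists_prog_input
  obtain ⟨P₂, C₂, h₂⟩ := modTransform_initVec
  obtain ⟨P₃, C₃, h₃⟩ := exists_prog_fold (modTransform_stepVec 0) (modTransform_stepVec 1)
  obtain ⟨P₄, C₄, h₄⟩ := modTransform_finalVec
  refine ⟨.seq P₁ (.seq P₂ (.seq P₃ P₄)), 2, fun W _ => ?_⟩
  obtain ⟨C₁, h₁⟩ := h₁ W
  -- The 2 absorbs the extra read at the end of the digits; the 16 comes from `mulCost_mul_size_le`.
  refine ⟨(C₁ + C₂ + 2 * C₃ + C₄ : ℕ) * 16, fun Q R m hQ hR _ hm hmQ => ?_⟩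
  obtain ⟨s₁, τ₁, e₁, hs₁, o₁, i₁, c₁⟩ := h₁ Q R m hR
  obtain ⟨s₂, τ₂, e₂, hs₂, u₂, i₂, c₂⟩ := h₂ R _ s₁ hR hs₁
  obtain ⟨s₃, τ₃, e₃, hs₃, c₃⟩ := h₃ R hR (Nat.digits 2 m).reverse
    (fun b hb => Nat.digits_lt_base one_lt_two (List.mem_reverse.mp hb)) _ s₂ hs₂
    (by rw [u₂ _ (by omega) (by omega), o₁]) (by rw [i₂, i₁])
  obtain ⟨s₄, τ₄, e₄, hs₄, -, -, c₄⟩ := h₄ R _ s₃ hR hs₃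
  have hv : initVec (inputVec Q) = encode (![1, 1, 0], ![alpha Q, beta Q, 1])
    (integralCurve Q) (denom Q) := rfl
  rw [hv, foldl_stepVec] at hs₄
  obtain ⟨ε, hε, r0, r1, r2⟩ := ladderCoords_spec Q hQ m hmQ
  refine ⟨s₄, _, ε, .seq e₁ (.seq e₂ (.seq e₃ e₄)), hε, ?_, ?_, ?_, ?_⟩
  · rw [← r0]
    exact hs₄.data 0
  · rw [← r1]
    exact hs₄.data 1
  · rw [← r2]
    exact hs₄.data 2
  · refine le_trans ?_ ((mul_le_mul_of_nonneg_left (mulCost_mul_size_le hR hm)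
      (Nat.cast_nonneg (C₁ + C₂ + 2 * C₃ + C₄))).trans_eq (by ring))
    rw [← Nat.cast_mul, Nat.cast_le]
    rw [List.length_reverse] at c₃
    have hd := length_digits_le m (by omega)
    have hs : 2 ≤ m.size := Nat.lt_size.mpr (by simpa using hm)
    have hM : mulCost R ≤ mulCost R * m.size := Nat.le_mul_of_pos_right _ (by omega)
    have hM' : mulCost R * ((Nat.digits 2 m).length + 1) ≤ 2 * (mulCost R * m.size) := by
      rw [mul_left_comm]
      exact Nat.mul_le_mul_left _ (by omega)
    have c₁' := c₁.trans (Nat.mul_le_mul_left C₁ hM)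
    have c₂' := c₂.trans (Nat.mul_le_mul_left C₂ hM)
    have c₃' := c₃.trans (Nat.mul_le_mul_left C₃ hM')
    have c₄' := c₄.trans (Nat.mul_le_mul_left C₄ hM)
    calc _ ≤ _ := add_le_add c₁' (add_le_add c₂' (add_le_add c₃' c₄'))
      _ = _ := by ring
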